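/- Fix an integer $n\ge 2$ and $a>0$. For $f:\mathbb{R}^n\to\mathbb{R}$ let $$\mathcal{R}_af(x)=\mathrm{P.V.}\int_{\mathbb{R}^n}\mathcal{K}_a(x-y)f(y)\,dy =\lim_{\varepsilon\to0^+}\int_{|x-y|>\varepsilon}\mathcal{K}_a(x-y)f(y)\,dy,$$ $$\mathcal{K}_a(z)=\frac{\Gamma(\frac{n+1}{2})}{\pi^{\frac{n+1}{2}}}\Big(\frac{z}{|z|^{n+1}}-\frac{z}{(|z|^2+a^2)^{\frac{n+1}{2}}}\Big).$$ Let $-1<\delta<1$ and let $f:\mathbb{R}^n\to\mathbb{R}$ be a radial, (radially) nondecreasing and continuously differentiable function with $\nabla f\in L^1(\mathbb{R}^n)\cap L^\infty(\mathbb{R}^n)$. Then the principal value $\mathcal{R}_af(x)$ exists for every $x\in\mathbb{R}^n$, both integrals below converge absolutely, and $$-\int_{\mathbb{R}^n}\frac{\mathcal{R}_a f(x)\cdot\nabla f(x)}{|x|^{n+\delta}}\,dx \;\ge\; C_{n,\delta}\int_{\mathbb{R}^n}\frac{(f(x)-f(0))^2}{|x|^{n+1+\delta}}\Big(1-\frac{2^{n+1}|x|^{n+1}}{(4|x|^2+a^2)^{\frac{n+1}{2}}}\Big)dx,$$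 where $$C_{n,\delta}=\frac{(\sqrt{n+1+\delta}-\sqrt{n})^2}{2^{n+2}\pi}\,B\Big(\tfrac12,\tfrac{n+1}{2}\Big)$$ and $B$ is the Euler beta function. -/

import Mathlib

open MeasureTheory Filter Topology
open scoped Gradient ENNReal

noncomputable section

/-- The kernel `K_a(z) = Γ((n+1)/2) / π^((n+1)/2) * (z / |z|^(n+1) - z / (|z|^2 + a^2)^((n+1)/2))`
on `ℝⁿ`. -/
def kernelKa (n : ℕ) (a : ℝ) (z : EuclideanSpace ℝ (Fin n)) : EuclideanSpace ℝ (Fin n) :=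
  (Real.Gamma (((n : ℝ) + 1) / 2) / Real.pi ^ (((n : ℝ) + 1) / 2)) •
    ((1 / ‖z‖ ^ (n + 1)) • z - (1 / (‖z‖ ^ 2 + a ^ 2) ^ (((n : ℝ) + 1) / 2)) • z)

/-- The truncated convolution `∫_{|x - y| > ε} K_a(x - y) f(y) dy`. -/
def truncRa (n : ℕ) (a : ℝ) (f : EuclideanSpace ℝ (Fin n) → ℝ) (x : EuclideanSpace ℝ (Fin n))
    (ε : ℝ) : EuclideanSpace ℝ (Fin n) :=
  ∫ y in {y | ε < ‖x - y‖}, f y • kernelKa n a (x - y)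

/-- The transform `R_a f(x) = P.V. ∫ K_a(x - y) f(y) dy`, the limit of the truncated integrals as
`ε → 0+`. -/
def transformRa (n : ℕ) (a : ℝ) (f : EuclideanSpace ℝ (Fin n) → ℝ)
    (x : EuclideanSpace ℝ (Fin n)) : EuclideanSpace ℝ (Fin n) :=
  limUnder (𝓝[>] (0 : ℝ)) (truncRa n a f x)

/-- The principal value defining `R_a f(x)` exists: each truncated integral converges absolutely,
and the truncated integrals converge as `ε → 0+`. -/
def PVExists (n : ℕ) (a : ℝ) (f : EuclideanSpace ℝ (Fin n) → ℝ)
    (x : EuclideanSpace ℝ (Fin n)) : Prop :=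
  (∀ ε : ℝ, 0 < ε → IntegrableOn (fun y => f y • kernelKa n a (x - y)) {y | ε < ‖x - y‖}) ∧
    ∃ L : EuclideanSpace ℝ (Fin n), Tendsto (truncRa n a f x) (𝓝[>] (0 : ℝ)) (𝓝 L)

/-- `f(x)` depends only on `|x|`. -/
def IsRadial {n : ℕ} (f : EuclideanSpace ℝ (Fin n) → ℝ) : Prop :=
  ∀ x y, ‖x‖ = ‖y‖ → f x = f y

/-- `f(x)` is nondecreasing in `|x|`. -/
def IsRadiallyNondecreasing {n : ℕ} (f : EuclideanSpace ℝ (Fin n) → ℝ) : Prop :=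
  ∀ x y, ‖x‖ ≤ ‖y‖ → f x ≤ f y

/-- The weight `1 - 2^(n+1) |x|^(n+1) / (4|x|^2 + a^2)^((n+1)/2)`. -/
def weightKS (n : ℕ) (a : ℝ) (x : EuclideanSpace ℝ (Fin n)) : ℝ :=
  1 - 2 ^ (n + 1) * ‖x‖ ^ (n + 1) / (4 * ‖x‖ ^ 2 + a ^ 2) ^ (((n : ℝ) + 1) / 2)

/-- `C_{n,δ} = (√(n+1+δ) - √n)^2 / (2^(n+2) π) * B(1/2, (n+1)/2)`, with `B` the Euler beta
function. -/
def constC (n : ℕ) (δ : ℝ) : ℝ :=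
  (√((n : ℝ) + 1 + δ) - √(n : ℝ)) ^ 2 / (2 ^ (n + 2) * Real.pi) *
    ProbabilityTheory.beta (1 / 2) (((n : ℝ) + 1) / 2)

end

/-! Since `f` is radial, `∇ f x` is a nonnegative multiple of `x`, so only `⟪R_a f(x), x⟫` matters.
Write the kernel as `c k(|z|) z` and average over the reflection `σ` in the hyperplane orthogonal to
`x`: `-⟪R_a f(x), x⟫ = (c/2) ∫ k(|z|) ⟪z, x⟫ (f(x+z) - f(x+σz)) dz`, whose integrand is nonnegative
because `f` is radially nondecreasing (`inner_transformRa_eq_symm`, `symmIntegrand_nonneg`).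

Keep only the ball `|x+z| < |x|` and its mirror image. There `|z| ≤ 2|x|`, so `k(|z|) ≥ k(2|x|)`;
this is the origin of the weight and of a factor `2^(n+1)`. What remains is `|x|² ∫ (f(x) - f(y))
dy` over the ball of radius `|x|`, a multiple of `G - U`, where `G(r) = f(re) - f(0)` for a unit
vector `e` and `U` is the ball average of `G` (`le_neg_inner_transformRa`).

In polar coordinates, with `s = 1 + δ`, the claim becomes `C ∫ r^(-s-1) W G² ≤ ∫ r^(-s) W G' (G -
U)` for a decreasing weight `W` (`hardy_ballAverage`). As `U' = n(G - U)/r`, the functional `r^(-s)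
W (s U²/(2n) + (G - U)²/2)` has derivative at most the difference of the two integrands, by a
quadratic form inequality (`quadratic_hardy`). It is nonnegative and tends to `0` at the origin,
which gives the result.

Convergence rests on `f` being Lipschitz and on the kernel being `O(|z|^(-n-2))` at infinity: the
principal value is the absolutely convergent integral of `(f(y) - f(x)) K_a(x - y)`. -/

/-- The profile `1 - (s² / (s² + a²))^m`, which is the ratio of the kernel of `R_a` to the Riesz
kernel at distance `s` when `m = (n + 1) / 2`. -/
noncomputable def cutoff (m a s : ℝ) : ℝ := 1 - (s ^ 2 / (s ^ 2 + a ^ 2)) ^ m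

/-! ### The cutoff profile -/

section Cutoff

variable {m a s t : ℝ}

theorem cutoff_nonneg (hm : 0 ≤ m) : 0 ≤ cutoff m a s := by
  have : (s ^ 2 / (s ^ 2 + a ^ 2)) ^ m ≤ 1 := by
    apply Real.rpow_le_one (by positivity) _ hm
    apply div_le_one_of_le₀ (by nlinarith [sq_nonneg a]) (by positivity)
  unfold cutoff; linarith

theorem cutoff_le_one : cutoff m a s ≤ 1 := by
  have : 0 ≤ (s ^ 2 / (s ^ 2 + a ^ 2)) ^ m := by positivity
  unfold cutoff; linarith

/-- Bernoulli's inequality. This quadratic decay is the gain of `K_a` over the Riesz kernel, and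
makes all integrals converge at infinity. -/
theorem cutoff_le (ha : 0 < a) (hm : 1 ≤ m) : cutoff m a s ≤ m * a ^ 2 / (s ^ 2 + a ^ 2) := by
  have hpos : 0 < s ^ 2 + a ^ 2 := by positivity
  have h1 : s ^ 2 / (s ^ 2 + a ^ 2) = 1 + -(a ^ 2 / (s ^ 2 + a ^ 2)) := by
    field_simp; ring
  have h2 := one_add_mul_self_le_rpow_one_add (s := -(a ^ 2 / (s ^ 2 + a ^ 2))) (by
    rw [neg_le_neg_iff]
    apply div_le_one_of_le₀ (by nlinarith [sq_nonneg s]) hpos.le) hm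
  unfold cutoff
  rw [h1, mul_div_assoc]
  linarith

theorem cutoff_anti (ha : 0 < a) (hm : 0 ≤ m) (hs : 0 ≤ s) (hst : s ≤ t) :
    cutoff m a t ≤ cutoff m a s := by
  unfold cutoff
  gcongr 1 - ?_
  apply Real.rpow_le_rpow (by positivity) _ hm
  rw [div_le_div_iff₀ (by positivity) (by positivity)]
  have : s ^ 2 ≤ t ^ 2 := by gcongr
  nlinarith [sq_nonneg a]

theorem exists_hasDerivAt_cutoff (ha : 0 < a) (hm : 0 ≤ m) (hs : 0 < s) :
    ∃ d ≤ 0, HasDerivAt (cutoff m a) d s := by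
  have hpos : 0 < s ^ 2 + a ^ 2 := by positivity
  have h1 : HasDerivAt (fun s : ℝ => s ^ 2) (2 * s) s := by simpa using hasDerivAt_pow 2 s
  have h2 : HasDerivAt (fun s : ℝ => s ^ 2 / (s ^ 2 + a ^ 2))
      ((2 * s * (s ^ 2 + a ^ 2) - s ^ 2 * (2 * s)) / (s ^ 2 + a ^ 2) ^ 2) s :=
    h1.div (h1.add_const (a ^ 2)) hpos.ne'
  have h0 : s ^ 2 / (s ^ 2 + a ^ 2) ≠ 0 := by positivity
  refine ⟨_, ?_, (h2.rpow_const (p := m) (Or.inl h0)).const_sub 1⟩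
  rw [neg_nonpos]
  have h3 : 0 ≤ 2 * s * (s ^ 2 + a ^ 2) - s ^ 2 * (2 * s) := by
    ring_nf; positivity
  positivity

theorem continuous_cutoff (ha : 0 < a) (hm : 0 ≤ m) : Continuous (cutoff m a) := by
  unfold cutoff
  refine continuous_const.sub (Continuous.rpow_const ?_ fun _ => Or.inr hm)
  exact Continuous.div (by fun_prop) (by fun_prop) fun s => by positivity

/-- The power of a quotient of squares at the exponent `(n + 1) / 2`. -/
theorem sq_div_rpow_half (n : ℕ) (hs : 0 ≤ s) :
    (s ^ 2 / (s ^ 2 + a ^ 2)) ^ (((n : ℝ) + 1) / 2) =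
      s ^ (n + 1) / (s ^ 2 + a ^ 2) ^ (((n : ℝ) + 1) / 2) := by
  rw [Real.div_rpow (by positivity) (by positivity)]
  congr 1
  rw [← Real.rpow_natCast s 2, ← Real.rpow_mul hs, ← Real.rpow_natCast s (n + 1)]
  congr 1
  push_cast; ring

end Cutoff

/-! ### The kernel and its integrability -/

/-- The constant `Γ((n+1)/2) / π^((n+1)/2)`. -/
noncomputable def rieszConst (n : ℕ) : ℝ :=
  Real.Gamma (((n : ℝ) + 1) / 2) / Real.pi ^ (((n : ℝ) + 1) / 2)

theorem rieszConst_pos (n : ℕ) : 0 < rieszConst n :=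
  div_pos (Real.Gamma_pos_of_pos (by positivity)) (by positivity)

/-- The scalar factor of the kernel, as a function of the distance. -/
noncomputable def kerProfile (n : ℕ) (a s : ℝ) : ℝ :=
  cutoff (((n : ℝ) + 1) / 2) a s / s ^ (n + 1)

section Kernel

variable {n : ℕ} {a s t : ℝ}

theorem kernelKa_eq (ha : 0 < a) (z : EuclideanSpace ℝ (Fin n)) :
    kernelKa n a z = (rieszConst n * kerProfile n a ‖z‖) • z := by
  rcases eq_or_ne z 0 with rfl | hz
  · simp [kernelKa]
  have hz' : 0 < ‖z‖ := norm_pos_iff.2 hz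
  have : 0 < (‖z‖ ^ 2 + a ^ 2) ^ (((n : ℝ) + 1) / 2) := by positivity
  rw [kernelKa, ← sub_smul, smul_smul, kerProfile, cutoff, sq_div_rpow_half n hz'.le, rieszConst]
  congr 2
  field_simp

/-- The argument `2‖x‖` is the diameter of the ball centred at the origin with `x` on its boundary.
-/
theorem weightKS_eq (x : EuclideanSpace ℝ (Fin n)) :
    weightKS n a x = cutoff (((n : ℝ) + 1) / 2) a (2 * ‖x‖) := by
  rw [weightKS, cutoff, sq_div_rpow_half n (by positivity), mul_pow, mul_pow]
  norm_num

theorem kerProfile_nonneg (hs : 0 ≤ s) : 0 ≤ kerProfile n a s :=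
  div_nonneg (cutoff_nonneg (by positivity)) (by positivity)

theorem kerProfile_anti (ha : 0 < a) (hs : 0 < s) (hst : s ≤ t) :
    kerProfile n a t ≤ kerProfile n a s := by
  unfold kerProfile
  exact div_le_div₀ (cutoff_nonneg (by positivity)) (cutoff_anti ha (by positivity) hs.le hst)
    (by positivity) (by gcongr)

theorem measurable_kerProfile (ha : 0 < a) : Measurable (kerProfile n a) :=
  (continuous_cutoff ha (by positivity)).measurable.div (by fun_prop)

theorem measurable_kernelKa (ha : 0 < a) : Measurable (kernelKa n a) := by
  have : kernelKa n a = fun z => (rieszConst n * kerProfile n a ‖z‖) • z :=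
    funext (kernelKa_eq ha)
  rw [this]
  exact (((measurable_kerProfile ha).comp measurable_norm).const_mul _).smul measurable_id

theorem kernelKa_neg (z : EuclideanSpace ℝ (Fin n)) : kernelKa n a (-z) = -kernelKa n a z := by
  simp only [kernelKa, norm_neg, smul_neg, neg_sub_neg]
  rw [← smul_neg, neg_sub]

theorem norm_kernelKa (ha : 0 < a) (z : EuclideanSpace ℝ (Fin n)) :
    ‖kernelKa n a z‖ = rieszConst n * kerProfile n a ‖z‖ * ‖z‖ := by
  rw [kernelKa_eq ha, norm_smul, Real.norm_of_nonneg]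
  exact mul_nonneg (rieszConst_pos n).le (kerProfile_nonneg (norm_nonneg _))

end Kernel

/-- `k(|z|) |z|^(2-α)` is integrable for `α < 1`. -/
theorem integrable_kerProfile_mul_rpow {n : ℕ} (hn : 2 ≤ n) {a α : ℝ} (ha : 0 < a)
    (hα : 0 ≤ α) (hα1 : α < 1) :
    Integrable (fun z : EuclideanSpace ℝ (Fin n) => kerProfile n a ‖z‖ * ‖z‖ ^ (2 - α)) := by
  have : Nonempty (Fin n) := ⟨⟨0, by omega⟩⟩
  rw [integrable_fun_norm_addHaar (μ := volume) (f := fun r => kerProfile n a r * r ^ (2 - α))]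
  simp only [finrank_euclideanSpace_fin, smul_eq_mul]
  have hmeas : Measurable fun y : ℝ => y ^ (n - 1) * (kerProfile n a y * y ^ (2 - α)) :=
    (measurable_id.pow_const _).mul ((measurable_kerProfile ha).mul (measurable_id.pow_const _))
  have key : ∀ y : ℝ, 0 < y → y ^ (n - 1) * (kerProfile n a y * y ^ (2 - α)) =
      cutoff (((n : ℝ) + 1) / 2) a y * y ^ (-α) := by
    intro y hy
    have h1 : y ^ (n + 1) = y ^ (n - 1) * y ^ 2 := by rw [← pow_add]; congr 1; omega
    have h2 : y ^ (2 - α) = y ^ 2 * y ^ (-α) := by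
      rw [sub_eq_add_neg, Real.rpow_add hy]; norm_num
    rw [kerProfile, h1, h2]
    field_simp
  have hm : (1 : ℝ) ≤ ((n : ℝ) + 1) / 2 := by
    have : (2 : ℝ) ≤ n := by exact_mod_cast hn
    linarith
  rw [← Set.Ioc_union_Ioi_eq_Ioi (zero_le_one' ℝ)]
  -- On `(0, 1]` the cutoff is at most `1` and `α < 1` suffices; beyond `1` the cutoff supplies
  -- `y^(-2)` and `y^(-α) ≤ 1`.
  refine IntegrableOn.union ?_ ?_
  · have hint : IntegrableOn (fun y : ℝ => y ^ (-α)) (Set.Ioc 0 1) :=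
      (intervalIntegrable_iff_integrableOn_Ioc_of_le zero_le_one).1
        (intervalIntegral.intervalIntegrable_rpow' (by linarith))
    refine Integrable.mono' hint hmeas.aestronglyMeasurable ?_
    filter_upwards [ae_restrict_mem measurableSet_Ioc] with y hy
    have h0 : 0 ≤ cutoff (((n : ℝ) + 1) / 2) a y := cutoff_nonneg (by positivity)
    have h1 : 0 ≤ y ^ (-α) := Real.rpow_nonneg hy.1.le _
    rw [key y hy.1, Real.norm_of_nonneg (by positivity)]
    exact mul_le_of_le_one_left h1 cutoff_le_one
  · have hint : IntegrableOn (fun y : ℝ => ((n : ℝ) + 1) / 2 * a ^ 2 * y ^ (-2 : ℝ)) (Set.Ioi 1) :=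
      (integrableOn_Ioi_rpow_of_lt (by norm_num) one_pos).const_mul _
    refine Integrable.mono' hint hmeas.aestronglyMeasurable ?_
    filter_upwards [ae_restrict_mem measurableSet_Ioi] with y hy
    have hy1 : (1 : ℝ) < y := hy
    have hy0 : (0 : ℝ) < y := by linarith
    have h0 : 0 ≤ cutoff (((n : ℝ) + 1) / 2) a y := cutoff_nonneg (by positivity)
    have h1 : 0 ≤ y ^ (-α) := Real.rpow_nonneg hy0.le _
    rw [key y hy0, Real.norm_of_nonneg (by positivity)]
    have h2 : y ^ (-α) ≤ 1 := Real.rpow_le_one_of_one_le_of_nonpos hy1.le (by linarith)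
    refine (mul_le_of_le_one_right h0 h2).trans ((cutoff_le ha hm).trans ?_)
    rw [Real.rpow_neg hy0.le, div_eq_mul_inv]
    gcongr
    norm_num
    positivity

theorem integrable_norm_mul_norm_kernelKa {n : ℕ} (hn : 2 ≤ n) {a : ℝ} (ha : 0 < a) :
    Integrable (fun z : EuclideanSpace ℝ (Fin n) => ‖z‖ * ‖kernelKa n a z‖) := by
  have h := (integrable_kerProfile_mul_rpow hn ha le_rfl one_pos).const_mul (rieszConst n)
  refine h.congr (ae_of_all _ fun z => ?_)
  simp only [norm_kernelKa ha, sub_zero]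
  norm_num
  ring

/-! ### Existence of the principal value -/

section PrincipalValue

variable {n : ℕ} {a L : ℝ} {f : EuclideanSpace ℝ (Fin n) → ℝ}

theorem integrable_sub_smul_kernelKa (hn : 2 ≤ n) (ha : 0 < a) (hf : Continuous f)
    (hL : ∀ x y, |f x - f y| ≤ L * ‖x - y‖) (x : EuclideanSpace ℝ (Fin n)) :
    Integrable (fun y => (f y - f x) • kernelKa n a (x - y)) := by
  have h := ((integrable_norm_mul_norm_kernelKa hn ha).comp_sub_left x).const_mul L
  refine h.mono' ?_ (ae_of_all _ fun y => ?_)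
  · exact ((hf.sub continuous_const).measurable.smul
      ((measurable_kernelKa ha).comp (measurable_const.sub measurable_id))).aestronglyMeasurable
  · rw [norm_smul, ← mul_assoc, norm_sub_rev x y]
    gcongr
    exact hL y x

theorem measurableSet_lt_norm_sub (x : EuclideanSpace ℝ (Fin n)) (ε : ℝ) :
    MeasurableSet {y | ε < ‖x - y‖} :=
  measurableSet_lt measurable_const (by fun_prop)

theorem integrableOn_kernelKa (hn : 2 ≤ n) (ha : 0 < a) (x : EuclideanSpace ℝ (Fin n)) {ε : ℝ}
    (hε : 0 < ε) : IntegrableOn (fun y => kernelKa n a (x - y)) {y | ε < ‖x - y‖} := by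
  have h := ((integrable_norm_mul_norm_kernelKa hn ha).comp_sub_left x).const_mul ε⁻¹
  refine h.integrableOn.mono' ?_ ?_
  · exact ((measurable_kernelKa ha).comp
      (measurable_const.sub measurable_id)).aestronglyMeasurable
  · filter_upwards [ae_restrict_mem (measurableSet_lt_norm_sub x ε)] with y hy
    have hy' : ε < ‖x - y‖ := hy
    rw [← mul_assoc]
    refine le_mul_of_one_le_left (norm_nonneg _) ?_
    rw [inv_mul_eq_div, one_le_div hε]
    exact hy'.le

/-- The kernel is odd and the domain symmetric about `x`, so subtracting the constant `f x` leaves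
each truncated integral unchanged. -/
theorem setIntegral_kernelKa (x : EuclideanSpace ℝ (Fin n)) (ε : ℝ) :
    ∫ y in {y | ε < ‖x - y‖}, kernelKa n a (x - y) = 0 := by
  rw [← integral_indicator (measurableSet_lt_norm_sub x ε)]
  set g : EuclideanSpace ℝ (Fin n) → EuclideanSpace ℝ (Fin n) :=
    {z | ε < ‖z‖}.indicator (kernelKa n a) with hg
  have h1 : ({y | ε < ‖x - y‖}.indicator fun y => kernelKa n a (x - y)) = fun y => g (x - y) := by
    ext1 y
    simp only [hg, Set.indicator, Set.mem_ofPred_eq]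
  rw [h1, integral_sub_left_eq_self g volume x]
  have h2 : ∫ z, g z = -∫ z, g z := by
    rw [← integral_neg, ← integral_neg_eq_self]
    congr 1
    ext1 z
    simp only [hg, Set.indicator, Set.mem_ofPred_eq, norm_neg, kernelKa_neg]
    split_ifs <;> simp
  rw [eq_neg_iff_add_eq_zero, ← two_smul ℝ] at h2
  simpa using h2

theorem integrableOn_smul_kernelKa (hn : 2 ≤ n) (ha : 0 < a) (hf : Continuous f)
    (hL : ∀ x y, |f x - f y| ≤ L * ‖x - y‖) (x : EuclideanSpace ℝ (Fin n)) {ε : ℝ} (hε : 0 < ε) :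
    IntegrableOn (fun y => f y • kernelKa n a (x - y)) {y | ε < ‖x - y‖} := by
  have h := (integrable_sub_smul_kernelKa hn ha hf hL x).integrableOn.add
    ((integrableOn_kernelKa hn ha x hε).smul (f x))
  refine h.congr (ae_of_all _ fun y => ?_)
  simp [sub_smul]

theorem tendsto_truncRa (hn : 2 ≤ n) (ha : 0 < a) (hf : Continuous f)
    (hL : ∀ x y, |f x - f y| ≤ L * ‖x - y‖) (x : EuclideanSpace ℝ (Fin n)) :
    Tendsto (truncRa n a f x) (𝓝[>] 0) (𝓝 (∫ y, (f y - f x) • kernelKa n a (x - y))) := by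
  have : Nonempty (Fin n) := ⟨⟨0, by omega⟩⟩
  have hcover : AECover volume (𝓝[>] (0 : ℝ))
      fun ε => {y : EuclideanSpace ℝ (Fin n) | ε < ‖x - y‖} := by
    refine ⟨?_, fun ε => measurableSet_lt_norm_sub x ε⟩
    filter_upwards [compl_mem_ae_iff.2 (measure_singleton x)] with y hy
    have : 0 < ‖x - y‖ := norm_pos_iff.2 (sub_ne_zero.2 (Ne.symm hy))
    exact (eventually_lt_nhds this).filter_mono nhdsWithin_le_nhds
  refine (hcover.integral_tendsto_of_countably_generated
    (integrable_sub_smul_kernelKa hn ha hf hL x)).congr' ?_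
  filter_upwards [self_mem_nhdsWithin] with ε hε
  rw [truncRa]
  simp only [sub_smul]
  have hint : IntegrableOn (fun y => f x • kernelKa n a (x - y)) {y | ε < ‖x - y‖} :=
    (integrableOn_kernelKa hn ha x hε).smul (f x)
  rw [integral_sub (integrableOn_smul_kernelKa hn ha hf hL x hε) hint, integral_smul, setIntegral_kernelKa,
    smul_zero, sub_zero]

theorem pvExists_of_lipschitz (hn : 2 ≤ n) (ha : 0 < a) (hf : Continuous f)
    (hL : ∀ x y, |f x - f y| ≤ L * ‖x - y‖) (x : EuclideanSpace ℝ (Fin n)) : PVExists n a f x :=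
  ⟨fun _ hε => integrableOn_smul_kernelKa hn ha hf hL x hε, _, tendsto_truncRa hn ha hf hL x⟩

theorem transformRa_eq_integral (hn : 2 ≤ n) (ha : 0 < a) (hf : Continuous f)
    (hL : ∀ x y, |f x - f y| ≤ L * ‖x - y‖) (x : EuclideanSpace ℝ (Fin n)) :
    transformRa n a f x = ∫ y, (f y - f x) • kernelKa n a (x - y) :=
  (tendsto_truncRa hn ha hf hL x).limUnder_eq

theorem stronglyMeasurable_transformRa (hn : 2 ≤ n) (ha : 0 < a) (hf : Continuous f)
    (hL : ∀ x y, |f x - f y| ≤ L * ‖x - y‖) : StronglyMeasurable (transformRa n a f) := by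
  rw [funext (transformRa_eq_integral hn ha hf hL)]
  refine StronglyMeasurable.integral_prod_right' (ν := volume)
    (f := fun p : EuclideanSpace ℝ (Fin n) × EuclideanSpace ℝ (Fin n) =>
      (f p.2 - f p.1) • kernelKa n a (p.1 - p.2)) ?_
  have h := hf.measurable
  exact (((h.comp measurable_snd).sub (h.comp measurable_fst)).smul
    ((measurable_kernelKa ha).comp (measurable_fst.sub measurable_snd))).stronglyMeasurable

theorem integrable_kerProfile_mul_inner (hn : 2 ≤ n) (ha : 0 < a) (hf : Continuous f)
    (hL : ∀ x y, |f x - f y| ≤ L * ‖x - y‖) (x : EuclideanSpace ℝ (Fin n)) :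
    Integrable (fun z => kerProfile n a ‖z‖ * inner ℝ z x * (f (x + z) - f x)) := by
  have h := ((integrable_kerProfile_mul_rpow hn ha le_rfl one_pos).const_mul (L * ‖x‖))
  refine h.mono' ?_ (ae_of_all _ fun z => ?_)
  · refine ((((measurable_kerProfile ha).comp measurable_norm).mul
      (by fun_prop : Continuous fun z => inner ℝ z x).measurable).mul
      (by fun_prop : Continuous fun z => f (x + z) - f x).measurable).aestronglyMeasurable
  · have hk : 0 ≤ kerProfile n a ‖z‖ := kerProfile_nonneg (norm_nonneg _)
    rw [norm_mul, norm_mul, Real.norm_of_nonneg hk, Real.norm_eq_abs, Real.norm_eq_abs]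
    have h1 : |f (x + z) - f x| ≤ L * ‖z‖ := by simpa using hL (x + z) x
    calc _ ≤ kerProfile n a ‖z‖ * (‖z‖ * ‖x‖) * (L * ‖z‖) := by
          gcongr
          exact abs_real_inner_le_norm z x
      _ = _ := by
          simp only [sub_zero]; norm_num; ring

theorem inner_transformRa (hn : 2 ≤ n) (ha : 0 < a) (hf : Continuous f)
    (hL : ∀ x y, |f x - f y| ≤ L * ‖x - y‖) (x : EuclideanSpace ℝ (Fin n)) :
    inner ℝ (transformRa n a f x) x =
      -(rieszConst n * ∫ z, kerProfile n a ‖z‖ * inner ℝ z x * (f (x + z) - f x)) := by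
  rw [transformRa_eq_integral hn ha hf hL, real_inner_comm,
    ← integral_inner (integrable_sub_smul_kernelKa hn ha hf hL x),
    ← integral_const_mul, ← integral_neg, ← integral_add_left_eq_self _ x]
  congr 1
  ext1 z
  rw [kernelKa_eq ha, sub_add_cancel_left, norm_neg, real_inner_comm, inner_smul_left,
    inner_smul_left, inner_neg_left]
  simp only [conj_trivial]
  ring

end PrincipalValue

/-! ### Symmetrization by reflection: bounds for `⟪R_a f(x), x⟫` -/

section Reflection

variable {n : ℕ} {a L : ℝ} {f : EuclideanSpace ℝ (Fin n) → ℝ}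

/-- The reflection in the hyperplane orthogonal to `x`. -/
noncomputable def hyperplaneReflection (x : EuclideanSpace ℝ (Fin n)) :
    EuclideanSpace ℝ (Fin n) ≃ₗᵢ[ℝ] EuclideanSpace ℝ (Fin n) :=
  (ℝ ∙ x)ᗮ.reflection

theorem inner_hyperplaneReflection (x z : EuclideanSpace ℝ (Fin n)) :
    inner ℝ (hyperplaneReflection x z) x = -inner ℝ z x := by
  have h : hyperplaneReflection x x = -x :=
    Submodule.reflection_orthogonalComplement_singleton_eq_neg x
  have h2 := (hyperplaneReflection x).inner_map_map z x
  rw [h, inner_neg_right] at h2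
  linarith

theorem hyperplaneReflection_apply_self (x z : EuclideanSpace ℝ (Fin n)) :
    hyperplaneReflection x (hyperplaneReflection x z) = z :=
  Submodule.reflection_reflection _ z

theorem norm_add_hyperplaneReflection_sq (x z : EuclideanSpace ℝ (Fin n)) :
    ‖x + hyperplaneReflection x z‖ ^ 2 = ‖x‖ ^ 2 - 2 * inner ℝ z x + ‖z‖ ^ 2 := by
  rw [norm_add_sq_real, real_inner_comm, inner_hyperplaneReflection, LinearIsometryEquiv.norm_map]
  ring

theorem norm_add_sq_comm (x z : EuclideanSpace ℝ (Fin n)) :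
    ‖x + z‖ ^ 2 = ‖x‖ ^ 2 + 2 * inner ℝ z x + ‖z‖ ^ 2 := by
  rw [norm_add_sq_real, real_inner_comm]

/-- The bound by `‖z‖` is the triangle inequality. For the bound by `‖x‖`, the squares of the two
norms differ by `4⟪z, x⟫`, while the sum of the norms is at least `‖z‖`. -/
theorem abs_norm_add_sub_le (x z : EuclideanSpace ℝ (Fin n)) :
    |‖x + z‖ - ‖x + hyperplaneReflection x z‖| ≤ 4 * min ‖x‖ ‖z‖ := by
  set σ := hyperplaneReflection x
  have hσ : ‖σ z‖ = ‖z‖ := σ.norm_map z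
  rw [mul_min_of_nonneg _ _ (by norm_num : (0 : ℝ) ≤ 4), le_min_iff]
  have h2 : |‖x + z‖ - ‖x + σ z‖| ≤ 2 * ‖z‖ := by
    have h3 := abs_norm_sub_norm_le (x + z) (x + σ z)
    have h4 : ‖x + z - (x + σ z)‖ ≤ ‖z‖ + ‖σ z‖ := by
      rw [add_sub_add_left_eq_sub]; exact norm_sub_le _ _
    linarith
  constructor
  · rcases eq_or_ne z 0 with rfl | hz
    · simp at h2 ⊢
    have hz' : 0 < ‖z‖ := norm_pos_iff.2 hz
    have e1 := norm_add_sq_comm x z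
    have e2 := norm_add_hyperplaneReflection_sq x z
    have hsum : ‖z‖ ≤ ‖x + z‖ + ‖x + σ z‖ := by
      refine abs_le_of_sq_le_sq' ?_ (by positivity) |>.2
      nlinarith [mul_nonneg (norm_nonneg (x + z)) (norm_nonneg (x + σ z)), sq_nonneg ‖x‖,
        sq_nonneg ‖z‖]
    have hcs := abs_real_inner_le_norm z x
    have hprod : |‖x + z‖ - ‖x + σ z‖| * (‖x + z‖ + ‖x + σ z‖) = 4 * |inner ℝ z x| := by
      rw [← abs_of_nonneg (by positivity : 0 ≤ ‖x + z‖ + ‖x + σ z‖), ← abs_mul,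
        show (4 : ℝ) = |4| by norm_num, ← abs_mul]
      congr 1
      linear_combination e1 - e2
    have h5 := mul_le_mul_of_nonneg_left hsum (abs_nonneg (‖x + z‖ - ‖x + σ z‖))
    refine le_of_mul_le_mul_right ?_ hz'
    nlinarith
  · linarith [norm_nonneg z]

/-- The integrand of `-⟪R_a f(x), x⟫` symmetrized under the reflection in the hyperplane
orthogonal to `x`. -/
noncomputable def symmIntegrand (n : ℕ) (a : ℝ) (f : EuclideanSpace ℝ (Fin n) → ℝ)
    (x z : EuclideanSpace ℝ (Fin n)) : ℝ :=
  kerProfile n a ‖z‖ * inner ℝ z x * (f (x + z) - f (x + hyperplaneReflection x z))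

theorem symmIntegrand_reflection (x z : EuclideanSpace ℝ (Fin n)) :
    symmIntegrand n a f x (hyperplaneReflection x z) = symmIntegrand n a f x z := by
  simp only [symmIntegrand, LinearIsometryEquiv.norm_map, inner_hyperplaneReflection,
    hyperplaneReflection_apply_self]
  ring

theorem symmIntegrand_eq (x : EuclideanSpace ℝ (Fin n)) :
    symmIntegrand n a f x = fun z => kerProfile n a ‖z‖ * inner ℝ z x * (f (x + z) - f x) +
      (fun z => kerProfile n a ‖z‖ * inner ℝ z x * (f (x + z) - f x))
        (hyperplaneReflection x z) := by
  ext1 z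
  simp only [symmIntegrand, LinearIsometryEquiv.norm_map, inner_hyperplaneReflection]
  ring

theorem integrable_symmIntegrand (hn : 2 ≤ n) (ha : 0 < a) (hf : Continuous f)
    (hL : ∀ x y, |f x - f y| ≤ L * ‖x - y‖) (x : EuclideanSpace ℝ (Fin n)) :
    Integrable (symmIntegrand n a f x) := by
  have h := integrable_kerProfile_mul_inner hn ha hf hL x
  rw [symmIntegrand_eq]
  exact h.add ((hyperplaneReflection x).measurePreserving.integrable_comp_of_integrable h)

theorem inner_transformRa_eq_symm (hn : 2 ≤ n) (ha : 0 < a) (hf : Continuous f)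
    (hL : ∀ x y, |f x - f y| ≤ L * ‖x - y‖) (x : EuclideanSpace ℝ (Fin n)) :
    inner ℝ (transformRa n a f x) x = -(rieszConst n / 2 * ∫ z, symmIntegrand n a f x z) := by
  have h := integrable_kerProfile_mul_inner hn ha hf hL x
  have h' := (hyperplaneReflection x).measurePreserving.integrable_comp_of_integrable h
  have he := (hyperplaneReflection x).measurePreserving.integral_comp
    (hyperplaneReflection x).toMeasurableEquiv.measurableEmbedding
    (fun z => kerProfile n a ‖z‖ * inner ℝ z x * (f (x + z) - f x))
  have e : ∫ z, symmIntegrand n a f x z =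
      (∫ z, kerProfile n a ‖z‖ * inner ℝ z x * (f (x + z) - f x)) +
        ∫ z, kerProfile n a ‖z‖ * inner ℝ z x * (f (x + z) - f x) := by
    rw [symmIntegrand_eq]
    exact (integral_add h h').trans (congrArg _ he)
  rw [e, inner_transformRa hn ha hf hL]
  ring

/-- Move both points onto one ray, where their distance is the difference of the norms. -/
theorem abs_sub_le_of_radial (hn : 2 ≤ n) (hrad : IsRadial f)
    (hL : ∀ x y, |f x - f y| ≤ L * ‖x - y‖) (x y : EuclideanSpace ℝ (Fin n)) :
    |f x - f y| ≤ L * |‖x‖ - ‖y‖| := by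
  set e : EuclideanSpace ℝ (Fin n) := EuclideanSpace.single ⟨0, by omega⟩ 1
  have he : ‖e‖ = 1 := by simp [e]
  rw [hrad x (‖x‖ • e) (by simp [norm_smul, he]), hrad y (‖y‖ • e) (by simp [norm_smul, he])]
  refine (hL _ _).trans_eq ?_
  rw [← sub_smul, norm_smul, he, mul_one, Real.norm_eq_abs]

/-- The exponent `α` interpolates `min ‖x‖ ‖z‖ ≤ ‖x‖^α ‖z‖^(1-α)`. A positive `α` buys extra
vanishing at the origin, needed for absolute convergence when `δ ≥ 0`; `α = 0` serves away from it.
-/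
theorem abs_inner_transformRa_le (hn : 2 ≤ n) (ha : 0 < a) (hf : Continuous f) (hL0 : 0 ≤ L)
    (hL : ∀ x y, |f x - f y| ≤ L * ‖x - y‖) (hrad : IsRadial f) {α : ℝ} (hα : 0 ≤ α)
    (hα1 : α < 1) (x : EuclideanSpace ℝ (Fin n)) (hx : x ≠ 0) :
    |inner ℝ (transformRa n a f x) x| ≤ rieszConst n / 2 * (4 * L *
      ∫ z : EuclideanSpace ℝ (Fin n), kerProfile n a ‖z‖ * ‖z‖ ^ (2 - α)) * ‖x‖ ^ (1 + α) := by
  have hx' : 0 < ‖x‖ := norm_pos_iff.2 hx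
  have hc := rieszConst_pos n
  rw [inner_transformRa_eq_symm hn ha hf hL, abs_neg, abs_mul, abs_of_pos (by positivity),
    mul_assoc]
  gcongr
  rw [mul_right_comm, ← integral_const_mul, ← Real.norm_eq_abs]
  refine norm_integral_le_of_norm_le
    ((integrable_kerProfile_mul_rpow hn ha hα hα1).const_mul _) (ae_of_all _ fun z => ?_)
  rcases eq_or_ne z 0 with rfl | hz
  · have hk : 0 ≤ kerProfile n a ‖(0 : EuclideanSpace ℝ (Fin n))‖ := kerProfile_nonneg (by simp)
    rw [symmIntegrand, inner_zero_left]
    simp only [mul_zero, zero_mul, norm_zero] at hk ⊢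
    positivity
  have hz' : 0 < ‖z‖ := norm_pos_iff.2 hz
  have hk : 0 ≤ kerProfile n a ‖z‖ := kerProfile_nonneg (norm_nonneg _)
  have hmin : min ‖x‖ ‖z‖ ≤ ‖x‖ ^ α * ‖z‖ ^ (1 - α) := by
    have hm : 0 < min ‖x‖ ‖z‖ := lt_min hx' hz'
    calc min ‖x‖ ‖z‖ = (min ‖x‖ ‖z‖) ^ α * (min ‖x‖ ‖z‖) ^ (1 - α) := by
          rw [← Real.rpow_add hm]; simp
      _ ≤ _ := by
          have h1 : 0 ≤ 1 - α := by linarith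
          gcongr
          · exact min_le_left _ _
          · exact min_le_right _ _
  rw [symmIntegrand, norm_mul, norm_mul, Real.norm_of_nonneg hk, Real.norm_eq_abs,
    Real.norm_eq_abs]
  calc _ ≤ kerProfile n a ‖z‖ * (‖z‖ * ‖x‖) * (L * (4 * (‖x‖ ^ α * ‖z‖ ^ (1 - α)))) := by
        gcongr
        · exact abs_real_inner_le_norm z x
        · refine (abs_sub_le_of_radial hn hrad hL _ _).trans ?_
          gcongr
          refine (abs_norm_add_sub_le x z).trans ?_
          gcongr
    _ = _ := by
        rw [Real.rpow_add hx', Real.rpow_one, show (2 - α) = 1 + (1 - α) by ring,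
          Real.rpow_add hz' 1, Real.rpow_one]
        ring

theorem symmIntegrand_nonneg (hmono : IsRadiallyNondecreasing f)
    (x z : EuclideanSpace ℝ (Fin n)) : 0 ≤ symmIntegrand n a f x z := by
  have hk : 0 ≤ kerProfile n a ‖z‖ := kerProfile_nonneg (norm_nonneg _)
  have e1 := norm_add_sq_comm x z
  have e2 := norm_add_hyperplaneReflection_sq x z
  rw [symmIntegrand, mul_assoc]
  refine mul_nonneg hk ?_
  rcases le_total 0 (inner ℝ z x) with h | h
  · refine mul_nonneg h (sub_nonneg.2 (hmono _ _ ?_))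
    exact abs_le_of_sq_le_sq' (by linarith) (norm_nonneg _) |>.2
  · refine mul_nonneg_of_nonpos_of_nonpos h (sub_nonpos.2 (hmono _ _ ?_))
    exact abs_le_of_sq_le_sq' (by linarith) (norm_nonneg _) |>.2

theorem inner_neg_of_norm_add_lt {x z : EuclideanSpace ℝ (Fin n)} (h : ‖x + z‖ < ‖x‖) :
    inner ℝ z x < 0 := by
  have e1 := norm_add_sq_comm x z
  have : ‖x + z‖ ^ 2 < ‖x‖ ^ 2 := by gcongr
  nlinarith [sq_nonneg ‖z‖]

/-- On the translated ball the symmetrized integrand dominates a multiple of `f(x) - f(x + z)`. -/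
theorem le_symmIntegrand (ha : 0 < a) (hmono : IsRadiallyNondecreasing f)
    {x z : EuclideanSpace ℝ (Fin n)} (h : ‖x + z‖ < ‖x‖) :
    kerProfile n a (2 * ‖x‖) * (-inner ℝ z x * (f x - f (x + z))) ≤ symmIntegrand n a f x z := by
  have hin := inner_neg_of_norm_add_lt h
  have e2 := norm_add_hyperplaneReflection_sq x z
  have hz : z ≠ 0 := by rintro rfl; simp at h
  have hz2 : ‖z‖ ≤ 2 * ‖x‖ := by
    have := norm_sub_le (x + z) x
    rw [add_sub_cancel_left] at this
    linarith
  have hk := kerProfile_anti (n := n) ha (norm_pos_iff.2 hz) hz2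
  have hk2 : 0 ≤ kerProfile n a (2 * ‖x‖) := kerProfile_nonneg (by positivity)
  have h1 : f (x + z) ≤ f x := hmono _ _ h.le
  -- As `⟪z, x⟫ < 0`, the reflected point `x + σz` lies outside the ball of radius `‖x‖`.
  have h2 : f x ≤ f (x + hyperplaneReflection x z) := hmono _ _
    (abs_le_of_sq_le_sq' (by nlinarith [sq_nonneg ‖z‖]) (norm_nonneg _) |>.2)
  have : symmIntegrand n a f x z =
      kerProfile n a ‖z‖ * (-inner ℝ z x * (f (x + hyperplaneReflection x z) - f (x + z))) := by
    rw [symmIntegrand]; ring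
  rw [this]
  have h3 : 0 ≤ -inner ℝ z x := by linarith
  have h4 : 0 ≤ f x - f (x + z) := by linarith
  have h5 := hk2.trans hk
  gcongr

/-- The factor `2` comes from the mirror image of the ball: it is disjoint from the ball, since `⟪z,
x⟫` changes sign, and the integrand is invariant under the reflection. -/
theorem le_integral_symmIntegrand (hn : 2 ≤ n) (ha : 0 < a) (hf : Continuous f)
    (hL : ∀ x y, |f x - f y| ≤ L * ‖x - y‖) (hmono : IsRadiallyNondecreasing f)
    (x : EuclideanSpace ℝ (Fin n)) :
    2 * ∫ z in {z | ‖x + z‖ < ‖x‖},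
      kerProfile n a (2 * ‖x‖) * (-inner ℝ z x * (f x - f (x + z))) ≤
      ∫ z, symmIntegrand n a f x z := by
  have hS : MeasurableSet {z | ‖x + z‖ < ‖x‖} := measurableSet_lt (by fun_prop) measurable_const
  have hint := integrable_symmIntegrand hn ha hf hL x
  set S := {z | ‖x + z‖ < ‖x‖}
  set Φ := symmIntegrand n a f x with hΦ
  set σ := hyperplaneReflection x
  have h1 : ∫ z in S, kerProfile n a (2 * ‖x‖) * (-inner ℝ z x * (f x - f (x + z))) ≤
      ∫ z in S, Φ z := by
    refine integral_mono_of_nonneg ?_ hint.integrableOn ?_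
    · filter_upwards [ae_restrict_mem hS] with z hz
      have hz' : ‖x + z‖ < ‖x‖ := hz
      have h2 : f (x + z) ≤ f x := hmono _ _ hz'.le
      exact mul_nonneg (kerProfile_nonneg (by positivity))
        (mul_nonneg (by linarith [inner_neg_of_norm_add_lt hz']) (by linarith))
    · filter_upwards [ae_restrict_mem hS] with z hz
      exact le_symmIntegrand ha hmono hz
  have hind : Integrable (S.indicator Φ) := hint.indicator hS
  have hind' : Integrable (fun z => S.indicator Φ (σ z)) :=
    σ.measurePreserving.integrable_comp_of_integrable hind
  have he : ∫ z, S.indicator Φ (σ z) = ∫ z, S.indicator Φ z :=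
    σ.measurePreserving.integral_comp σ.toMeasurableEquiv.measurableEmbedding _
  have h2 : ∫ z, (S.indicator Φ z + S.indicator Φ (σ z)) ≤ ∫ z, Φ z := by
    refine integral_mono (hind.add hind') hint fun z => ?_
    have h0 : 0 ≤ Φ z := symmIntegrand_nonneg hmono x z
    have hr : Φ (σ z) = Φ z := symmIntegrand_reflection x z
    simp only [Set.indicator]
    split_ifs with h3 h4
    · have h5 := inner_neg_of_norm_add_lt h3
      have h6 := inner_neg_of_norm_add_lt h4
      rw [inner_hyperplaneReflection] at h6
      linarith
    · simp
    · simp [hr]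
    · simpa using h0
  rw [integral_add hind hind', he, integral_indicator hS] at h2
  linarith

/-- With `y = x + z` one has `-⟪z, x⟫ = ‖x‖² - ⟪y, x⟫`, and the second term integrates to zero by
oddness. -/
theorem setIntegral_inner_mul_sub (hf : Continuous f) (hrad : IsRadial f)
    (x : EuclideanSpace ℝ (Fin n)) :
    ∫ z in {z | ‖x + z‖ < ‖x‖}, -inner ℝ z x * (f x - f (x + z)) =
      ‖x‖ ^ 2 * ∫ y in Metric.ball 0 ‖x‖, (f x - f y) := by
  have hS : MeasurableSet {z | ‖x + z‖ < ‖x‖} := measurableSet_lt (by fun_prop) measurable_const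
  have hfb : ∀ {g : EuclideanSpace ℝ (Fin n) → ℝ}, Continuous g →
      IntegrableOn g (Metric.ball 0 ‖x‖) := fun hg =>
    (hg.continuousOn.integrableOn_compact (isCompact_closedBall 0 ‖x‖)).mono_set
      Metric.ball_subset_closedBall
  have hodd : ∫ y in Metric.ball 0 ‖x‖, inner ℝ y x * (f x - f y) = 0 := by
    rw [← integral_indicator measurableSet_ball]
    have h : ∀ I : ℝ, I = -I → I = 0 := fun I hI => by linarith
    apply h
    rw [← integral_neg, ← integral_neg_eq_self]
    congr 1
    ext1 y
    have : f (-y) = f y := hrad _ _ (norm_neg y)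
    simp only [Set.indicator, mem_ball_zero_iff, norm_neg, inner_neg_left, this]
    split_ifs <;> simp
  rw [← integral_indicator hS]
  have h1 : ({z | ‖x + z‖ < ‖x‖}.indicator fun z => -inner ℝ z x * (f x - f (x + z))) =
      fun z => (Metric.ball 0 ‖x‖).indicator
        (fun y => ‖x‖ ^ 2 * (f x - f y) - inner ℝ y x * (f x - f y)) (x + z) := by
    ext1 z
    simp only [Set.indicator, Set.mem_ofPred_eq, mem_ball_zero_iff, inner_add_left,
      real_inner_self_eq_norm_sq]
    congr 1
    ring
  rw [h1, integral_add_left_eq_self, integral_indicator measurableSet_ball, integral_sub,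
    hodd, sub_zero, integral_const_mul]
  · exact hfb (by fun_prop)
  · exact hfb (by fun_prop)

/-- Lower bound for `-⟪R_a f(x), x⟫` by the average deficit of `f` on the ball of radius `|x|`. -/
theorem le_neg_inner_transformRa (hn : 2 ≤ n) (ha : 0 < a) (hf : Continuous f)
    (hL : ∀ x y, |f x - f y| ≤ L * ‖x - y‖) (hrad : IsRadial f)
    (hmono : IsRadiallyNondecreasing f) (x : EuclideanSpace ℝ (Fin n)) :
    rieszConst n * (kerProfile n a (2 * ‖x‖) *
      (‖x‖ ^ 2 * ∫ y in Metric.ball 0 ‖x‖, (f x - f y))) ≤ -inner ℝ (transformRa n a f x) x := by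
  have h := le_integral_symmIntegrand hn ha hf hL hmono x
  rw [integral_const_mul, setIntegral_inner_mul_sub hf hrad] at h
  rw [inner_transformRa_eq_symm hn ha hf hL, neg_neg]
  nlinarith [rieszConst_pos n]

end Reflection

/-! ### A one-dimensional weighted Hardy inequality -/

/-- The average of the radial function `G(|y|)` over the ball of radius `r` in dimension `n`. -/
noncomputable def ballAverage (n : ℕ) (G : ℝ → ℝ) (r : ℝ) : ℝ :=
  n / r ^ n * ∫ ρ in (0 : ℝ)..r, ρ ^ (n - 1) * G ρ

section Hardy

variable {n : ℕ} {G g W : ℝ → ℝ} {s L r : ℝ}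

theorem integral_pow_pred (hn : 1 ≤ n) (r : ℝ) :
    ∫ ρ in (0 : ℝ)..r, ρ ^ (n - 1) = r ^ n / n := by
  rw [integral_pow, Nat.sub_add_cancel hn, zero_pow (by omega), sub_zero, Nat.cast_sub hn]
  simp

theorem hasDerivAt_ballAverage (hn : 1 ≤ n) (hG : Continuous G) (hr : 0 < r) :
    HasDerivAt (ballAverage n G) (n * (G r - ballAverage n G r) / r) r := by
  have h1 : HasDerivAt (fun r => ∫ ρ in (0 : ℝ)..r, ρ ^ (n - 1) * G ρ) (r ^ (n - 1) * G r) r :=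
    intervalIntegral.integral_hasDerivAt_right
      (Continuous.intervalIntegrable (by fun_prop) _ _)
      (Continuous.stronglyMeasurableAtFilter (by fun_prop) _ _) (by fun_prop)
  have h2 : HasDerivAt (fun r : ℝ => (n : ℝ) / r ^ n)
      (-(n * (n * r ^ (n - 1))) / (r ^ n) ^ 2) r := by
    have := (hasDerivAt_const r (n : ℝ)).fun_div (hasDerivAt_pow n r) (pow_ne_zero n hr.ne')
    rwa [zero_mul, zero_sub] at this
  have h3 : r ^ n = r ^ (n - 1) * r := by rw [← pow_succ]; congr 1; omega
  refine (h2.fun_mul h1).congr_deriv ?_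
  unfold ballAverage
  rw [h3]
  field_simp
  ring

theorem ballAverage_nonneg (hG0 : ∀ r, 0 ≤ r → 0 ≤ G r) (hr : 0 ≤ r) :
    0 ≤ ballAverage n G r := by
  refine mul_nonneg (by positivity) (intervalIntegral.integral_nonneg hr fun ρ hρ => ?_)
  exact mul_nonneg (pow_nonneg hρ.1 _) (hG0 _ hρ.1)

theorem ballAverage_le (hn : 1 ≤ n) (hG : Continuous G) (hmono : MonotoneOn G (Set.Ici 0))
    (hr : 0 < r) : ballAverage n G r ≤ G r := by
  have h : ∫ ρ in (0 : ℝ)..r, ρ ^ (n - 1) * G ρ ≤ ∫ ρ in (0 : ℝ)..r, ρ ^ (n - 1) * G r := by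
    refine intervalIntegral.integral_mono_on hr.le
      (Continuous.intervalIntegrable (by fun_prop) _ _)
      (Continuous.intervalIntegrable (by fun_prop) _ _) fun ρ hρ => ?_
    have := hmono hρ.1 hr.le hρ.2
    have := pow_nonneg hρ.1 (n - 1)
    gcongr
  rw [intervalIntegral.integral_mul_const, integral_pow_pred hn] at h
  have hn' : (0 : ℝ) < n := by exact_mod_cast hn
  calc ballAverage n G r ≤ n / r ^ n * (r ^ n / n * G r) := by
        unfold ballAverage; gcongr
    _ = G r := by field_simp

/-- The quadratic form inequality behind the weighted Hardy inequality. -/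
theorem quadratic_hardy {N s C : ℝ} (hN : 0 < N) (hs : 0 < s) (hC : C ≤ s ^ 2 / (2 * (2 * N + s)))
    (G U : ℝ) :
    s * U * (G - U) - N * (G - U) ^ 2 + C * G ^ 2 ≤ s * (s / (2 * N) * U ^ 2 + (G - U) ^ 2 / 2) := by
  have h1 : C * G ^ 2 ≤ s ^ 2 / (2 * (2 * N + s)) * G ^ 2 := by gcongr
  -- The slack is a perfect square, vanishing when `2N(G - U) = sU`; this fixes the threshold for
  -- `C`.
  have h2 : s * (s / (2 * N) * U ^ 2 + (G - U) ^ 2 / 2) - (s * U * (G - U) - N * (G - U) ^ 2) -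
      s ^ 2 / (2 * (2 * N + s)) * G ^ 2 =
      (N + s) / (2 * N * (2 * N + s)) * (2 * N * (G - U) - s * U) ^ 2 := by
    field_simp
    ring
  have h3 : 0 ≤ (N + s) / (2 * N * (2 * N + s)) * (2 * N * (G - U) - s * U) ^ 2 := by positivity
  linarith

/-- The Lyapunov-type functional used to prove the weighted Hardy inequality. -/
noncomputable def hardyFunctional (n : ℕ) (s : ℝ) (W G : ℝ → ℝ) (r : ℝ) : ℝ :=
  r ^ (-s) * W r * (s / (2 * n) * ballAverage n G r ^ 2 + (G r - ballAverage n G r) ^ 2 / 2)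

/-- Differentiating `(G - U)²/2` produces `g (G - U)`; the other terms carry a factor `1/r` and form
the quadratic form of `quadratic_hardy`, except for the term with `W'`, which is nonpositive. -/
theorem exists_hasDerivAt_hardyFunctional_le {C : ℝ} (hn : 1 ≤ n) (hs : 0 < s)
    (hC : C ≤ s ^ 2 / (2 * (2 * n + s))) (hG : Continuous G) (hr : 0 < r)
    (hg : HasDerivAt G (g r) r) (hW0 : 0 ≤ W r) (hW : ∃ d ≤ 0, HasDerivAt W d r) :
    ∃ d, d ≤ r ^ (-s) * W r * g r * (G r - ballAverage n G r) -
        C * (r ^ (-s - 1) * W r * G r ^ 2) ∧ HasDerivAt (hardyFunctional n s W G) d r := by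
  obtain ⟨w, hw0, hw⟩ := hW
  have hn' : (0 : ℝ) < n := by exact_mod_cast hn
  have hU := hasDerivAt_ballAverage hn hG hr
  have hp := Real.hasDerivAt_rpow_const (p := -s) (Or.inl hr.ne')
  have hq := ((hU.fun_pow 2).const_mul (s / (2 * n))).fun_add
    (((hg.fun_sub hU).fun_pow 2).div_const 2)
  refine ⟨_, ?_, (hp.fun_mul hw).fun_mul hq⟩
  have hquad := quadratic_hardy hn' hs hC (G r) (ballAverage n G r)
  have hrp : r ^ (-s) = r * r ^ (-s - 1) := by
    rw [Real.rpow_sub_one hr.ne']; field_simp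
  have hp0 : 0 ≤ r ^ (-s - 1) := Real.rpow_nonneg hr.le _
  rw [hrp]
  generalize ballAverage n G r = U at *
  generalize G r = x at *
  generalize r ^ (-s - 1) = p at *
  have hq0 : 0 ≤ s / (2 * n) * U ^ 2 + (x - U) ^ 2 / 2 := by positivity
  have h1 : 0 ≤ p * W r * (s * (s / (2 * n) * U ^ 2 + (x - U) ^ 2 / 2) -
      (s * U * (x - U) - n * (x - U) ^ 2 + C * x ^ 2)) :=
    mul_nonneg (mul_nonneg hp0 hW0) (by linarith)
  have h2 : 0 ≤ r * p * (-w) * (s / (2 * n) * U ^ 2 + (x - U) ^ 2 / 2) := by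
    have : 0 ≤ -w := by linarith
    positivity
  rw [← sub_nonneg]
  refine (add_nonneg h1 h2).trans_eq ?_
  field_simp
  ring

theorem hardyFunctional_nonneg (hs : 0 < s) (hr : 0 ≤ r) (hW0 : 0 ≤ W r) :
    0 ≤ hardyFunctional n s W G r := by
  have := Real.rpow_nonneg hr (-s)
  unfold hardyFunctional
  positivity

theorem hardyFunctional_le (hn : 1 ≤ n) (hs : 0 < s) (hG : Continuous G)
    (hG0 : ∀ r, 0 ≤ r → 0 ≤ G r) (hmono : MonotoneOn G (Set.Ici 0)) (hGL : G r ≤ L * r)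
    (hr : 0 < r) (hW1 : W r ≤ 1) :
    hardyFunctional n s W G r ≤ (s / (2 * n) + 1 / 2) * L ^ 2 * r ^ (2 - s) := by
  have hU0 := ballAverage_nonneg (n := n) hG0 hr.le
  have hU1 := ballAverage_le hn hG hmono hr
  have hG0 := hG0 r hr.le
  have hp := Real.rpow_nonneg hr.le (-s)
  have h2 : r ^ (2 - s) = r ^ (-s) * r ^ 2 := by
    rw [sub_eq_neg_add, Real.rpow_add hr]; norm_num
  unfold hardyFunctional
  generalize ballAverage n G r = U at *
  calc _ ≤ r ^ (-s) * 1 * (s / (2 * n) * (L * r) ^ 2 + (L * r) ^ 2 / 2) := by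
        gcongr
        · linarith
        · linarith
    _ = _ := by rw [h2]; ring

/-- A weighted Hardy-type inequality comparing a monotone function with its ball averages. -/
theorem hardy_ballAverage {C : ℝ} (hn : 1 ≤ n) (hs : 0 < s) (hs2 : s < 2)
    (hC : C ≤ s ^ 2 / (2 * (2 * n + s))) (hG : Continuous G)
    (hg : ∀ r, 0 < r → HasDerivAt G (g r) r)
    (hG0 : ∀ r, 0 ≤ r → 0 ≤ G r) (hmono : MonotoneOn G (Set.Ici 0))
    (hGL : ∀ r, 0 ≤ r → G r ≤ L * r) (hW0 : ∀ r, 0 < r → 0 ≤ W r) (hW1 : ∀ r, 0 < r → W r ≤ 1)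
    (hW : ∀ r, 0 < r → ∃ d ≤ 0, HasDerivAt W d r)
    (hA : IntegrableOn (fun r => r ^ (-s) * W r * g r * (G r - ballAverage n G r)) (Set.Ioi 0))
    (hB : IntegrableOn (fun r => r ^ (-s - 1) * W r * G r ^ 2) (Set.Ioi 0)) :
    C * ∫ r in Set.Ioi 0, r ^ (-s - 1) * W r * G r ^ 2 ≤
      ∫ r in Set.Ioi 0, r ^ (-s) * W r * g r * (G r - ballAverage n G r) := by
  set D : ℝ → ℝ := fun r => r ^ (-s) * W r * g r * (G r - ballAverage n G r) -
    C * (r ^ (-s - 1) * W r * G r ^ 2) with hD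
  have hDint : IntegrableOn D (Set.Ioi 0) := hA.sub (hB.const_mul C)
  suffices h : 0 ≤ ∫ r in Set.Ioi 0, D r by
    rw [hD, integral_sub hA (hB.const_mul C), integral_const_mul] at h
    linarith
  have hderiv : ∀ r, 0 < r → ∃ d, d ≤ D r ∧ HasDerivAt (hardyFunctional n s W G) d r :=
    fun r hr => exists_hasDerivAt_hardyFunctional_le hn hs hC hG hr (hg r hr) (hW0 r hr) (hW r hr)
  choose! d hd1 hd2 using hderiv
  have hcov : AECover (volume.restrict (Set.Ioi (0 : ℝ))) atTop
      fun R : ℝ => Set.Ioi R⁻¹ ∩ Set.Iic R :=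
    (aecover_Ioi_of_Ioi tendsto_inv_atTop_zero).inter
      ((aecover_Iic tendsto_id).mono Measure.restrict_le_self)
  have hlim := hcov.integral_tendsto_of_countably_generated hDint
  have hlim2 : Tendsto (fun R : ℝ => -((s / (2 * n) + 1 / 2) * L ^ 2 * R⁻¹ ^ (2 - s))) atTop
      (𝓝 0) := by
    have h1 : Tendsto (fun R : ℝ => R⁻¹ ^ (2 - s)) atTop (𝓝 0) := by
      have := tendsto_inv_atTop_zero (𝕜 := ℝ).rpow_const (p := 2 - s) (Or.inr (by linarith))
      rwa [Real.zero_rpow (by linarith)] at this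
    simpa using (h1.const_mul ((s / (2 * n) + 1 / 2) * L ^ 2)).neg
  refine le_of_tendsto_of_tendsto hlim2 hlim ?_
  filter_upwards [eventually_ge_atTop 1] with R hR
  have hR0 : 0 < R := by linarith
  have hRi : 0 < R⁻¹ := by positivity
  have hRR : R⁻¹ ≤ R := (inv_le_one_of_one_le₀ hR).trans hR
  have hsub : Set.Ioi R⁻¹ ∩ Set.Iic R ⊆ Set.Ioi 0 := fun x hx => hRi.trans hx.1
  rw [Measure.restrict_restrict (measurableSet_Ioi.inter measurableSet_Iic),
    Set.inter_eq_left.2 hsub, Set.Ioi_inter_Iic, ← intervalIntegral.integral_of_le hRR]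
  -- Only the majorant `D` has to be integrable; nothing is required of the derivative `d` beyond `d
  -- ≤ D`.
  have h := intervalIntegral.sub_le_integral_of_hasDeriv_right_of_le (φ := D) (g' := d) hRR
    (fun x hx => (hd2 x (hRi.trans_le hx.1)).continuousAt.continuousWithinAt)
    (fun x hx => (hd2 x (hRi.trans hx.1)).hasDerivWithinAt)
    (hDint.mono_set fun x hx => hRi.trans_le hx.1)
    (fun x hx => hd1 x (hRi.trans hx.1))
  have h1 := hardyFunctional_nonneg (n := n) (G := G) hs hR0.le (hW0 R hR0)
  have h2 := hardyFunctional_le hn hs hG hG0 hmono (hGL R⁻¹ hRi.le) hRi (hW1 _ hRi)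
  linarith

end Hardy

/-! ### Radial functions and their profiles along a ray -/

section RadialProfile

variable {n : ℕ} {a L : ℝ} {f : EuclideanSpace ℝ (Fin n) → ℝ} {e : EuclideanSpace ℝ (Fin n)}

theorem continuous_gradient (hf : ContDiff ℝ 1 f) : Continuous (∇ f) :=
  (InnerProductSpace.toDual ℝ _).symm.continuous.comp (hf.continuous_fderiv one_ne_zero)

theorem exists_norm_gradient_le (hf : ContDiff ℝ 1 f) (hLinf : MemLp (∇ f) ∞ volume) :
    ∃ L, 0 ≤ L ∧ ∀ x, ‖∇ f x‖ ≤ L := by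
  refine ⟨(eLpNormEssSup (∇ f) volume).toReal, ENNReal.toReal_nonneg, ?_⟩
  have hfin : eLpNormEssSup (∇ f) volume ≠ ∞ := by
    have := hLinf.2
    rw [eLpNorm_exponent_top] at this
    exact this.ne
  have hae : ∀ᵐ x, ‖∇ f x‖ ≤ (eLpNormEssSup (∇ f) volume).toReal := by
    filter_upwards [ae_le_eLpNormEssSup (f := ∇ f) (μ := volume)] with x hx
    rw [← toReal_enorm]
    exact ENNReal.toReal_mono hfin hx
  have hcl : IsClosed {x | ‖∇ f x‖ ≤ (eLpNormEssSup (∇ f) volume).toReal} :=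
    isClosed_le (continuous_gradient hf).norm continuous_const
  intro x
  -- The gradient is continuous, so the essential bound, valid on a dense set, holds everywhere.
  exact hcl.closure_subset_iff.2 subset_rfl (Measure.dense_of_ae hae x)

theorem abs_sub_le_of_norm_gradient_le (hf : ContDiff ℝ 1 f) (hL : ∀ x, ‖∇ f x‖ ≤ L)
    (x y : EuclideanSpace ℝ (Fin n)) : |f x - f y| ≤ L * ‖x - y‖ := by
  refine convex_univ.norm_image_sub_le_of_norm_fderiv_le (𝕜 := ℝ) (f := f)
    (fun z _ => (hf.differentiable one_ne_zero).differentiableAt) (fun z _ => ?_)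
    (Set.mem_univ y) (Set.mem_univ x)
  rw [← toDual_gradient, LinearIsometryEquiv.norm_map]
  exact hL z

theorem hasDerivAt_radialProfile (hf : ContDiff ℝ 1 f) (e : EuclideanSpace ℝ (Fin n)) (r : ℝ) :
    HasDerivAt (fun r : ℝ => f (r • e)) (inner ℝ (∇ f (r • e)) e) r := by
  have h1 : HasDerivAt (fun r : ℝ => r • e) e r := by
    simpa using (hasDerivAt_id r).smul_const e
  have h2 := (hf.differentiable one_ne_zero (r • e)).hasFDerivAt.comp_hasDerivAt r h1
  rwa [← inner_gradient_left] at h2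

theorem eq_radialProfile (hrad : IsRadial f) (he : ‖e‖ = 1) (x : EuclideanSpace ℝ (Fin n)) :
    f x = f (‖x‖ • e) := hrad _ _ (by simp [norm_smul, he])

theorem gradient_eq_of_radial (hf : ContDiff ℝ 1 f) (hrad : IsRadial f) (he : ‖e‖ = 1)
    {x : EuclideanSpace ℝ (Fin n)} (hx : x ≠ 0) :
    ∇ f x = (inner ℝ (∇ f (‖x‖ • e)) e / ‖x‖) • x := by
  have hx' : ‖x‖ ≠ 0 := norm_ne_zero_iff.2 hx
  have h1 : HasFDerivAt (fun x : EuclideanSpace ℝ (Fin n) => ‖x‖) (‖x‖⁻¹ • innerSL ℝ x) x := by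
    have h2 := (hasStrictFDerivAt_norm_sq x).hasFDerivAt.sqrt (by positivity)
    simp only [Real.sqrt_sq (norm_nonneg _)] at h2
    refine h2.congr_fderiv (ContinuousLinearMap.ext fun y => ?_)
    simp
    field_simp
  have h3 := (hasDerivAt_radialProfile hf e ‖x‖).comp_hasFDerivAt x h1
  have h4 : (fun r : ℝ => f (r • e)) ∘ (fun x : EuclideanSpace ℝ (Fin n) => ‖x‖) = f :=
    funext fun y => (eq_radialProfile hrad he y).symm
  rw [h4] at h3
  refine HasGradientAt.gradient ?_
  rw [hasGradientAt_iff_hasFDerivAt]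
  refine h3.congr_fderiv (ContinuousLinearMap.ext fun y => ?_)
  simp
  ring

theorem radialProfile_monotoneOn (hmono : IsRadiallyNondecreasing f)
    (e : EuclideanSpace ℝ (Fin n)) : MonotoneOn (fun r : ℝ => f (r • e)) (Set.Ici 0) := by
  intro r hr s hs hrs
  apply hmono
  rw [norm_smul, norm_smul, Real.norm_of_nonneg hr, Real.norm_of_nonneg hs]
  gcongr

theorem radialProfile_deriv_nonneg (hf : ContDiff ℝ 1 f) (hmono : IsRadiallyNondecreasing f)
    (e : EuclideanSpace ℝ (Fin n)) {r : ℝ} (hr : 0 < r) : 0 ≤ inner ℝ (∇ f (r • e)) e := by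
  have h := (hasDerivAt_radialProfile hf e r)
  rw [← h.hasDerivWithinAt.derivWithin (uniqueDiffOn_Ici 0 r hr.le)]
  exact (radialProfile_monotoneOn hmono e).derivWithin_nonneg

theorem setIntegral_ball_sub_eq (hn : 2 ≤ n) (hf : Continuous f) (hrad : IsRadial f)
    (he : ‖e‖ = 1) (x : EuclideanSpace ℝ (Fin n)) (hx : x ≠ 0) :
    ∫ y in Metric.ball 0 ‖x‖, (f x - f y) =
      volume.real (Metric.ball (0 : EuclideanSpace ℝ (Fin n)) 1) * ‖x‖ ^ n *
        (f (‖x‖ • e) - f 0 - ballAverage n (fun r => f (r • e) - f 0) ‖x‖) := by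
  have : Nonempty (Fin n) := ⟨⟨0, by omega⟩⟩
  have hx' : 0 < ‖x‖ := norm_pos_iff.2 hx
  have hn' : (0 : ℝ) < n := by positivity
  rw [eq_radialProfile hrad he x]
  generalize ‖x‖ = r at *
  set G : ℝ → ℝ := fun r => f (r • e) - f 0 with hG
  have hGc : Continuous G := by fun_prop
  have h1 : ∫ y in Metric.ball 0 r, (f (r • e) - f y) =
      ∫ y : EuclideanSpace ℝ (Fin n), (Set.Iio r).indicator (fun ρ => G r - G ρ) ‖y‖ := by
    rw [← integral_indicator measurableSet_ball]
    congr 1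
    ext1 y
    simp only [Set.indicator, mem_ball_zero_iff, Set.mem_Iio, hG, ← eq_radialProfile hrad he y,
      sub_sub_sub_cancel_right]
  have h2 : ∫ ρ in Set.Ioi (0 : ℝ), ρ ^ (n - 1) • (Set.Iio r).indicator (fun ρ => G r - G ρ) ρ =
      ∫ ρ in (0 : ℝ)..r, (ρ ^ (n - 1) * G r - ρ ^ (n - 1) * G ρ) := by
    rw [intervalIntegral.integral_of_le hx'.le, integral_Ioc_eq_integral_Ioo,
      ← Set.Ioi_inter_Iio, Set.inter_comm, ← Measure.restrict_restrict measurableSet_Iio,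
      ← integral_indicator measurableSet_Iio]
    congr 1
    ext1 ρ
    simp only [Set.indicator, smul_eq_mul]
    split_ifs <;> ring
  rw [h1, integral_fun_norm_addHaar, finrank_euclideanSpace_fin, h2,
    intervalIntegral.integral_sub (Continuous.intervalIntegrable (by fun_prop) _ _)
      (Continuous.intervalIntegrable (by fun_prop) _ _), intervalIntegral.integral_mul_const,
    integral_pow_pred (by omega)]
  unfold ballAverage
  simp only [smul_eq_mul, nsmul_eq_mul]
  have hrn : r ^ n ≠ 0 := by positivity
  field_simp
  rfl

/-- The powers of `π` combine, and the quotient of Gamma values becomes the beta function of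
`constC` because `Γ(1/2) = √π`. -/
theorem rieszConst_mul_volume_ball (hn : 2 ≤ n) :
    rieszConst n * volume.real (Metric.ball (0 : EuclideanSpace ℝ (Fin n)) 1) =
      ProbabilityTheory.beta (1 / 2) (((n : ℝ) + 1) / 2) / Real.pi := by
  have : Nonempty (Fin n) := ⟨⟨0, by omega⟩⟩
  have hg : 0 < Real.Gamma ((n : ℝ) / 2 + 1) := Real.Gamma_pos_of_pos (by positivity)
  have hpi := Real.pi_pos
  rw [measureReal_def, EuclideanSpace.volume_ball, ENNReal.ofReal_one, one_pow, one_mul,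
    ENNReal.toReal_ofReal (by positivity), Fintype.card_fin, rieszConst, ProbabilityTheory.beta,
    Real.Gamma_one_half_eq, show (1 : ℝ) / 2 + ((n : ℝ) + 1) / 2 = n / 2 + 1 by ring]
  have h1 : Real.pi ^ (((n : ℝ) + 1) / 2) = √Real.pi ^ n * √Real.pi := by
    rw [← pow_succ, Real.sqrt_eq_rpow, ← Real.rpow_natCast, ← Real.rpow_mul hpi.le]
    congr 1
    push_cast; ring
  have h2 : √Real.pi * √Real.pi = Real.pi := Real.mul_self_sqrt hpi.le
  rw [h1]
  field_simp
  rw [sq, h2]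

end RadialProfile

/-! ### Integrability and the final inequality -/

section Main

variable {n : ℕ} {a L δ : ℝ} {f : EuclideanSpace ℝ (Fin n) → ℝ} {e : EuclideanSpace ℝ (Fin n)}

theorem integrable_inner_transformRa (hn : 2 ≤ n) (ha : 0 < a) (hδ : -1 < δ) (hδ' : δ < 1)
    (hrad : IsRadial f) (hf : ContDiff ℝ 1 f) (hL1 : MemLp (∇ f) 1 volume)
    (hL0 : 0 ≤ L) (hgrad : ∀ x, ‖∇ f x‖ ≤ L) (he : ‖e‖ = 1) :
    Integrable (fun x : EuclideanSpace ℝ (Fin n) =>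
      inner ℝ (transformRa n a f x) (∇ f x) / ‖x‖ ^ ((n : ℝ) + δ)) := by
  have : Nonempty (Fin n) := ⟨⟨0, by omega⟩⟩
  have hLip := abs_sub_le_of_norm_gradient_le hf hgrad
  have hn2 : (2 : ℝ) ≤ n := by exact_mod_cast hn
  -- `α > δ` makes `‖x‖^(α-n-δ)` integrable near the origin. Outside the unit ball `α = 0` is used,
  -- and `∇ f ∈ L¹` gives convergence.
  obtain ⟨α, hα0, hαδ, hα1⟩ : ∃ α, 0 ≤ α ∧ δ < α ∧ α < 1 := by
    obtain ⟨α, h1, h2⟩ := exists_between (max_lt hδ' one_pos)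
    exact ⟨α, (le_max_right _ _).trans h1.le, (le_max_left _ _).trans_lt h1, h2⟩
  set M : ℝ → ℝ := fun α => rieszConst n / 2 * (4 * L *
      ∫ z : EuclideanSpace ℝ (Fin n), kerProfile n a ‖z‖ * ‖z‖ ^ (2 - α)) with hM
  have hM0 : ∀ α, 0 ≤ M α := fun α => by
    have h1 := rieszConst_pos n
    have h2 : 0 ≤ ∫ z : EuclideanSpace ℝ (Fin n), kerProfile n a ‖z‖ * ‖z‖ ^ (2 - α) :=
      integral_nonneg fun z => mul_nonneg (kerProfile_nonneg (norm_nonneg _))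
        (Real.rpow_nonneg (norm_nonneg _) _)
    simp only [hM]
    positivity
  have hbound : ∀ α, 0 ≤ α → α < 1 → ∀ x : EuclideanSpace ℝ (Fin n), x ≠ 0 →
      ‖inner ℝ (transformRa n a f x) (∇ f x) / ‖x‖ ^ ((n : ℝ) + δ)‖ ≤
        ‖∇ f x‖ * (M α * ‖x‖ ^ (α - n - δ)) := by
    intro α hα0 hα1 x hx
    have hx' : 0 < ‖x‖ := norm_pos_iff.2 hx
    have h1 := abs_inner_transformRa_le hn ha hf.continuous hL0 hLip hrad hα0 hα1 x hx
    have hg := gradient_eq_of_radial hf hrad he hx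
    set c := inner ℝ (∇ f (‖x‖ • e)) e / ‖x‖
    have h2 : ‖∇ f x‖ = |c| * ‖x‖ := by rw [hg, norm_smul, Real.norm_eq_abs]
    rw [h2, hg, inner_smul_right, norm_div, norm_mul, Real.norm_eq_abs, Real.norm_eq_abs,
      Real.norm_of_nonneg (by positivity), div_le_iff₀ (by positivity)]
    calc _ ≤ |c| * (M α * ‖x‖ ^ (1 + α)) := by gcongr
      _ = |c| * ‖x‖ * (M α * (‖x‖ ^ (α - n - δ) * ‖x‖ ^ ((n : ℝ) + δ))) := by
        rw [← Real.rpow_add hx', show α - n - δ + (n + δ) = α by ring, Real.rpow_add hx',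
          Real.rpow_one]
        ring
      _ = _ := by ring
  have hint1 : Integrable ((Metric.ball (0 : EuclideanSpace ℝ (Fin n)) 1).indicator
      fun x => L * (M α * ‖x‖ ^ (α - n - δ))) := by
    rw [integrable_indicator_iff measurableSet_ball]
    refine Integrable.const_mul (Integrable.const_mul ?_ _) _
    rw [← IntegrableOn, integrableOn_fun_norm_addHaar volume (f := fun r => r ^ (α - n - δ))]
    have h1 : IntegrableOn (fun y : ℝ => y ^ (α - δ - 1)) (Set.Ioo 0 1) :=
      ((intervalIntegrable_iff_integrableOn_Ioo_of_le zero_le_one).1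
        (intervalIntegral.intervalIntegrable_rpow' (by linarith)))
    refine h1.congr_fun (fun y hy => ?_) measurableSet_Ioo
    simp only [finrank_euclideanSpace_fin, smul_eq_mul]
    rw [← Real.rpow_natCast, ← Real.rpow_add hy.1, Nat.cast_sub (by omega)]
    congr 1
    push_cast
    ring
  have hint2 : Integrable (fun x => ‖∇ f x‖ * M 0) :=
    (memLp_one_iff_integrable.1 hL1).norm.mul_const _
  refine (hint1.add hint2).mono' ?_ ?_
  · refine AEStronglyMeasurable.div₀ ?_ (Measurable.aestronglyMeasurable (by fun_prop))
    exact ((stronglyMeasurable_transformRa hn ha hf.continuous hLip).aestronglyMeasurable).inner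
      (continuous_gradient hf).aestronglyMeasurable
  filter_upwards [compl_mem_ae_iff.2 (measure_singleton (0 : EuclideanSpace ℝ (Fin n)))] with x hx
  have hx' : 0 < ‖x‖ := norm_pos_iff.2 hx
  have hp : 0 ≤ ‖x‖ ^ (α - n - δ) := by positivity
  simp only [Pi.add_apply]
  by_cases h : ‖x‖ < 1
  · rw [Set.indicator_of_mem (by simpa using h)]
    refine (hbound α hα0 hα1 x hx).trans (le_add_of_le_of_nonneg ?_ ?_)
    · have := hgrad x
      have := hM0 α
      gcongr
    · exact mul_nonneg (norm_nonneg _) (hM0 0)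
  · rw [Set.indicator_of_notMem (by simpa using h), zero_add]
    refine (hbound 0 le_rfl one_pos x hx).trans ?_
    have h3 : ‖x‖ ^ (0 - n - δ) ≤ 1 :=
      Real.rpow_le_one_of_one_le_of_nonpos (not_lt.1 h) (by linarith)
    have := hM0 0
    gcongr
    exact mul_le_of_le_one_right this h3

theorem integrableOn_cutoff_mul_sq (hn : 2 ≤ n) (ha : 0 < a) {s : ℝ} (hs : 0 < s) (hs2 : s < 2)
    {G : ℝ → ℝ} (hG : Continuous G) (hG0 : ∀ r, 0 ≤ r → 0 ≤ G r)
    (hGL : ∀ r, 0 ≤ r → G r ≤ L * r) :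
    IntegrableOn (fun r => r ^ (-s - 1) * cutoff (((n : ℝ) + 1) / 2) a (2 * r) * G r ^ 2)
      (Set.Ioi 0) := by
  have hmeas : Measurable fun r : ℝ =>
      r ^ (-s - 1) * cutoff (((n : ℝ) + 1) / 2) a (2 * r) * G r ^ 2 := by
    have h1 := (continuous_cutoff (m := ((n : ℝ) + 1) / 2) ha (by positivity)).measurable
    have h2 := hG.measurable
    fun_prop
  have hm : (1 : ℝ) ≤ ((n : ℝ) + 1) / 2 := by
    have : (2 : ℝ) ≤ n := by exact_mod_cast hn
    linarith
  have hpow : ∀ r : ℝ, 0 < r → r ^ (1 - s) = r ^ (-s - 1) * r ^ 2 := fun r hr => by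
    rw [show 1 - s = (-s - 1) + 2 by ring, Real.rpow_add hr]; norm_num
  have hle : ∀ r : ℝ, 0 < r →
      ‖r ^ (-s - 1) * cutoff (((n : ℝ) + 1) / 2) a (2 * r) * G r ^ 2‖ ≤
        cutoff (((n : ℝ) + 1) / 2) a (2 * r) * (L ^ 2 * (r ^ (-s - 1) * r ^ 2)) := by
    intro r hr
    have h0 : 0 ≤ cutoff (((n : ℝ) + 1) / 2) a (2 * r) := cutoff_nonneg (by positivity)
    have h1 : 0 ≤ r ^ (-s - 1) := Real.rpow_nonneg hr.le _
    have h2 := hG0 r hr.le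
    have h3 := hGL r hr.le
    rw [Real.norm_of_nonneg (by positivity)]
    calc _ ≤ r ^ (-s - 1) * cutoff (((n : ℝ) + 1) / 2) a (2 * r) * (L * r) ^ 2 := by gcongr
      _ = _ := by ring
  rw [← Set.Ioc_union_Ioi_eq_Ioi (zero_le_one' ℝ)]
  refine IntegrableOn.union ?_ ?_
  · have hint : IntegrableOn (fun y : ℝ => L ^ 2 * y ^ (1 - s)) (Set.Ioc 0 1) :=
      ((intervalIntegrable_iff_integrableOn_Ioc_of_le zero_le_one).1
        (intervalIntegral.intervalIntegrable_rpow' (by linarith))).const_mul _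
    refine Integrable.mono' hint hmeas.aestronglyMeasurable ?_
    filter_upwards [ae_restrict_mem measurableSet_Ioc] with y hy
    have h1 : 0 ≤ y ^ (-s - 1) := Real.rpow_nonneg hy.1.le _
    refine (hle y hy.1).trans ?_
    rw [hpow y hy.1]
    exact mul_le_of_le_one_left (by positivity) cutoff_le_one
  · have hint : IntegrableOn (fun y : ℝ => ((n : ℝ) + 1) / 2 * a ^ 2 * L ^ 2 * y ^ (-s - 1))
        (Set.Ioi 1) :=
      (integrableOn_Ioi_rpow_of_lt (by linarith) one_pos).const_mul _
    refine Integrable.mono' hint hmeas.aestronglyMeasurable ?_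
    filter_upwards [ae_restrict_mem measurableSet_Ioi] with y hy
    have hy0 : (0 : ℝ) < y := one_pos.trans hy
    have h1 : 0 ≤ y ^ (-s - 1) := Real.rpow_nonneg hy0.le _
    refine (hle y hy0).trans ?_
    have h2 : cutoff (((n : ℝ) + 1) / 2) a (2 * y) ≤ ((n : ℝ) + 1) / 2 * a ^ 2 / y ^ 2 := by
      refine (cutoff_le ha hm).trans ?_
      gcongr
      nlinarith [sq_nonneg a, sq_nonneg y]
    calc _ ≤ ((n : ℝ) + 1) / 2 * a ^ 2 / y ^ 2 * (L ^ 2 * (y ^ (-s - 1) * y ^ 2)) := by gcongr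
      _ = _ := by field_simp

/-- The Hardy inequality holds with the larger constant on the right. Here `s = (√(N+s) - √N)(√(N+s)
+ √N)`, and the square of the last factor is at least `2N + s`. -/
theorem sq_sqrt_sub_sqrt_le {N s : ℝ} (hN : 0 < N) (hs : 0 < s) :
    (√(N + s) - √N) ^ 2 / 2 ≤ s ^ 2 / (2 * (2 * N + s)) := by
  have h1 := Real.sq_sqrt hN.le
  have h2 := Real.sq_sqrt (add_pos hN hs).le
  have hp := Real.sqrt_nonneg N
  have hq := Real.sqrt_nonneg (N + s)
  rw [div_le_div_iff₀ (by norm_num) (by positivity)]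
  have h3 : s = (√(N + s) - √N) * (√(N + s) + √N) := by linear_combination h1 - h2
  have h4 : 2 * N + s ≤ (√(N + s) + √N) ^ 2 := by nlinarith [mul_nonneg hp hq]
  have h5 := mul_le_mul_of_nonneg_left h4 (sq_nonneg (√(N + s) - √N))
  have h6 : s ^ 2 = (√(N + s) - √N) ^ 2 * (√(N + s) + √N) ^ 2 := by
    rw [← mul_pow, ← h3]
  linarith

theorem measurable_ballAverage {G : ℝ → ℝ} (hG : Continuous G) : Measurable (ballAverage n G) := by
  have h : Continuous fun r => ∫ ρ in (0 : ℝ)..r, ρ ^ (n - 1) * G ρ :=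
    intervalIntegral.continuous_primitive
      (fun _ _ => Continuous.intervalIntegrable (by fun_prop) _ _) 0
  have h' := h.measurable
  unfold ballAverage
  fun_prop

/-- Pointwise lower bound of the integrand by a radial function. -/
theorem le_neg_inner_transformRa_gradient (hn : 2 ≤ n) (ha : 0 < a) (hrad : IsRadial f)
    (hmono : IsRadiallyNondecreasing f) (hf : ContDiff ℝ 1 f) (hgrad : ∀ x, ‖∇ f x‖ ≤ L)
    (he : ‖e‖ = 1) {x : EuclideanSpace ℝ (Fin n)} (hx : x ≠ 0) :
    rieszConst n * volume.real (Metric.ball (0 : EuclideanSpace ℝ (Fin n)) 1) / 2 ^ (n + 1) *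
        (‖x‖ ^ (-(n : ℝ) - δ) * cutoff (((n : ℝ) + 1) / 2) a (2 * ‖x‖) *
          inner ℝ (∇ f (‖x‖ • e)) e *
          (f (‖x‖ • e) - f 0 - ballAverage n (fun r => f (r • e) - f 0) ‖x‖)) ≤
      -(inner ℝ (transformRa n a f x) (∇ f x) / ‖x‖ ^ ((n : ℝ) + δ)) := by
  have hLip := abs_sub_le_of_norm_gradient_le hf hgrad
  have hx' : 0 < ‖x‖ := norm_pos_iff.2 hx
  have h1 := le_neg_inner_transformRa hn ha hf.continuous hLip hrad hmono x
  rw [setIntegral_ball_sub_eq hn hf.continuous hrad he x hx] at h1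
  have hg := radialProfile_deriv_nonneg hf hmono e hx'
  rw [gradient_eq_of_radial hf hrad he hx, inner_smul_right, ← neg_div, ← mul_neg]
  have h2 : ‖x‖ ^ (-(n : ℝ) - δ) = (‖x‖ ^ ((n : ℝ) + δ))⁻¹ := by
    rw [← Real.rpow_neg hx'.le]; congr 1; ring
  refine le_trans (le_of_eq ?_) (div_le_div_of_nonneg_right
    (mul_le_mul_of_nonneg_left h1 (div_nonneg hg hx'.le)) (by positivity))
  rw [h2, kerProfile, mul_pow, pow_succ ‖x‖ n]
  field_simp

end Main

theorem proposition4p5 (n : ℕ) (hn : 2 ≤ n) (a : ℝ) (ha : 0 < a) (δ : ℝ) (hδ : -1 < δ)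
    (hδ' : δ < 1) (f : EuclideanSpace ℝ (Fin n) → ℝ) (hrad : IsRadial f)
    (hmono : IsRadiallyNondecreasing f) (hf : ContDiff ℝ 1 f)
    (hL1 : MemLp (∇ f) 1 volume) (hLinf : MemLp (∇ f) ∞ volume) :
    (∀ x, PVExists n a f x) ∧
    Integrable (fun x : EuclideanSpace ℝ (Fin n) =>
      inner ℝ (transformRa n a f x) (∇ f x) / ‖x‖ ^ ((n : ℝ) + δ)) ∧
    Integrable (fun x : EuclideanSpace ℝ (Fin n) =>
      (f x - f 0) ^ 2 / ‖x‖ ^ ((n : ℝ) + 1 + δ) * weightKS n a x) ∧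
    -∫ x : EuclideanSpace ℝ (Fin n),
        inner ℝ (transformRa n a f x) (∇ f x) / ‖x‖ ^ ((n : ℝ) + δ) ≥
      constC n δ * ∫ x : EuclideanSpace ℝ (Fin n),
        (f x - f 0) ^ 2 / ‖x‖ ^ ((n : ℝ) + 1 + δ) * weightKS n a x := by
  have : Nonempty (Fin n) := ⟨⟨0, by omega⟩⟩
  obtain ⟨L, hL0, hgrad⟩ := exists_norm_gradient_le hf hLinf
  have hLip := abs_sub_le_of_norm_gradient_le hf hgrad
  obtain ⟨e, he⟩ : ∃ e : EuclideanSpace ℝ (Fin n), ‖e‖ = 1 :=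
    ⟨EuclideanSpace.single ⟨0, by omega⟩ 1, by simp⟩
  have hn' : (0 : ℝ) < n := by positivity
  have hI := integrable_inner_transformRa (δ := δ) hn ha hδ hδ' hrad hf hL1 hL0 hgrad he
  set G : ℝ → ℝ := fun r => f (r • e) - f 0 with hGdef
  set g : ℝ → ℝ := fun r => inner ℝ (∇ f (r • e)) e with hgdef
  set W : ℝ → ℝ := fun r => cutoff (((n : ℝ) + 1) / 2) a (2 * r) with hWdef
  set v := volume.real (Metric.ball (0 : EuclideanSpace ℝ (Fin n)) 1) with hv
  set κ := rieszConst n * v / 2 ^ (n + 1) with hκ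
  have hfc := hf.continuous
  have hGc : Continuous G := by fun_prop
  have hgc : Continuous g := by
    have := continuous_gradient hf
    fun_prop
  have hWc : Continuous W :=
    (continuous_cutoff (m := ((n : ℝ) + 1) / 2) ha (by positivity)).comp (by fun_prop)
  have hGmono : MonotoneOn G (Set.Ici 0) := fun r hr s hs hrs =>
    sub_le_sub_right (radialProfile_monotoneOn hmono e hr hs hrs) _
  have hG0 : ∀ r, 0 ≤ r → 0 ≤ G r := fun r _ => sub_nonneg.2 (hmono _ _ (by simp))
  have hGL : ∀ r, 0 ≤ r → G r ≤ L * r := fun r hr => by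
    have := (le_abs_self _).trans (hLip (r • e) 0)
    rwa [sub_zero, norm_smul, he, mul_one, Real.norm_of_nonneg hr] at this
  have hGd : ∀ r, 0 < r → HasDerivAt G (g r) r := fun r _ =>
    (hasDerivAt_radialProfile hf e r).sub_const _
  have hW0 : ∀ r, 0 < r → 0 ≤ W r := fun r _ => cutoff_nonneg (by positivity)
  have hWd : ∀ r, 0 < r → ∃ d ≤ 0, HasDerivAt W d r := fun r hr => by
    obtain ⟨d, hd, h⟩ := exists_hasDerivAt_cutoff (m := ((n : ℝ) + 1) / 2) (s := 2 * r) ha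
      (by positivity) (by positivity)
    have h2 : HasDerivAt (fun r : ℝ => 2 * r) 2 r := by
      simpa using (hasDerivAt_id r).const_mul 2
    exact ⟨d * 2, by linarith, h.comp r h2⟩
  have hvpos : 0 < v := by
    rw [hv, measureReal_def]
    exact ENNReal.toReal_pos (Metric.measure_ball_pos _ _ one_pos).ne' measure_ball_lt_top.ne
  have hκpos : 0 < κ := by
    have := rieszConst_pos n
    positivity
  have hB := integrableOn_cutoff_mul_sq (L := L) (s := 1 + δ) hn ha (by linarith) (by linarith)
    hGc hG0 hGL
  -- the right-hand integral in polar coordinates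
  have hRfun : (fun x : EuclideanSpace ℝ (Fin n) =>
      (f x - f 0) ^ 2 / ‖x‖ ^ ((n : ℝ) + 1 + δ) * weightKS n a x) =
      fun x => (fun r => G r ^ 2 / r ^ ((n : ℝ) + 1 + δ) * W r) ‖x‖ := by
    ext1 x
    simp only [weightKS_eq, hGdef, hWdef, ← eq_radialProfile hrad he x]
  have hRpolar : Set.EqOn (fun r => r ^ (-(1 + δ) - 1) * W r * G r ^ 2)
      (fun r : ℝ => r ^ (n - 1) • (G r ^ 2 / r ^ ((n : ℝ) + 1 + δ) * W r)) (Set.Ioi 0) := by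
    intro r hr
    have hr' : 0 < r := hr
    have : r ^ (-(1 + δ) - 1) = r ^ (n - 1) / r ^ ((n : ℝ) + 1 + δ) := by
      rw [← Real.rpow_natCast, ← Real.rpow_sub hr', Nat.cast_sub (by omega)]
      congr 1
      push_cast; ring
    simp only [smul_eq_mul, this]
    ring
  have hR : Integrable (fun x : EuclideanSpace ℝ (Fin n) =>
      (f x - f 0) ^ 2 / ‖x‖ ^ ((n : ℝ) + 1 + δ) * weightKS n a x) := by
    rw [hRfun, integrable_fun_norm_addHaar volume
      (f := fun r => G r ^ 2 / r ^ ((n : ℝ) + 1 + δ) * W r), finrank_euclideanSpace_fin]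
    exact hB.congr_fun hRpolar measurableSet_Ioi
  refine ⟨pvExists_of_lipschitz hn ha hfc hLip, hI, hR, ?_⟩
  -- the radial minorant of the left-hand integrand
  set φ : ℝ → ℝ := fun r => κ * (r ^ (-(n : ℝ) - δ) * W r * g r * (G r - ballAverage n G r))
    with hφ
  have hφmeas : Measurable φ := by
    have h1 := hGc.measurable
    have h2 := hgc.measurable
    have h3 := hWc.measurable
    have h4 := measurable_ballAverage (n := n) hGc
    fun_prop
  have hφ0 : ∀ x : EuclideanSpace ℝ (Fin n), x ≠ 0 → 0 ≤ φ ‖x‖ := by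
    intro x hx
    have hx' : 0 < ‖x‖ := norm_pos_iff.2 hx
    have h1 : 0 ≤ g ‖x‖ := radialProfile_deriv_nonneg hf hmono e hx'
    have h2 := ballAverage_le (n := n) (by omega) hGc hGmono hx'
    have h3 := hW0 _ hx'
    have h4 : 0 ≤ G ‖x‖ - ballAverage n G ‖x‖ := by linarith
    simp only [hφ]
    positivity
  have hφle : ∀ᵐ x : EuclideanSpace ℝ (Fin n), φ ‖x‖ ≤
      -(inner ℝ (transformRa n a f x) (∇ f x) / ‖x‖ ^ ((n : ℝ) + δ)) := by
    filter_upwards [compl_mem_ae_iff.2 (measure_singleton (0 : EuclideanSpace ℝ (Fin n)))] with x hx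
    exact le_neg_inner_transformRa_gradient hn ha hrad hmono hf hgrad he hx
  have hφ0' : ∀ᵐ x : EuclideanSpace ℝ (Fin n), 0 ≤ φ ‖x‖ := by
    filter_upwards [compl_mem_ae_iff.2 (measure_singleton (0 : EuclideanSpace ℝ (Fin n)))] with x hx
    exact hφ0 x hx
  -- Integrability of the minorant, and hence of the first Hardy integrand, is inherited from the
  -- left-hand integrand through `0 ≤ φ ≤ …`.
  have hφint : Integrable (fun x : EuclideanSpace ℝ (Fin n) => φ ‖x‖) := by
    refine hI.neg.mono' (hφmeas.comp measurable_norm).aestronglyMeasurable ?_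
    filter_upwards [hφle, hφ0'] with x h1 h2
    rw [Real.norm_of_nonneg h2]
    exact h1
  have hφpolar : Set.EqOn (fun r : ℝ => r ^ (n - 1) • φ r)
      (fun r => κ * (r ^ (-(1 + δ)) * W r * g r * (G r - ballAverage n G r))) (Set.Ioi 0) := by
    intro r hr
    have hr' : 0 < r := hr
    have : r ^ (-(1 + δ)) = r ^ (n - 1) * r ^ (-(n : ℝ) - δ) := by
      rw [← Real.rpow_natCast, ← Real.rpow_add hr', Nat.cast_sub (by omega)]
      congr 1
      push_cast; ring
    simp only [hφ, smul_eq_mul, this]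
    ring
  have hA : IntegrableOn (fun r => r ^ (-(1 + δ)) * W r * g r * (G r - ballAverage n G r))
      (Set.Ioi 0) := by
    rw [integrable_fun_norm_addHaar volume (f := φ), finrank_euclideanSpace_fin] at hφint
    have h1 := (hφint.congr_fun hφpolar measurableSet_Ioi).const_mul κ⁻¹
    refine IntegrableOn.congr_fun h1 (fun r _ => ?_) measurableSet_Ioi
    exact inv_mul_cancel_left₀ hκpos.ne' _
  have hC := sq_sqrt_sub_sqrt_le hn' (by linarith : 0 < 1 + δ)
  have hmain := hardy_ballAverage (by omega : 1 ≤ n) (by linarith) (by linarith) hC hGc hGd hG0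
    hGmono hGL hW0 (fun _ _ => cutoff_le_one) hWd hA hB
  have hle : ∫ x : EuclideanSpace ℝ (Fin n), φ ‖x‖ ≤ -∫ x : EuclideanSpace ℝ (Fin n),
        inner ℝ (transformRa n a f x) (∇ f x) / ‖x‖ ^ ((n : ℝ) + δ) := by
    rw [← integral_neg]
    exact integral_mono_ae hφint hI.neg hφle
  refine le_trans ?_ hle
  have hconst : constC n δ = κ * ((√((n : ℝ) + (1 + δ)) - √(n : ℝ)) ^ 2 / 2) := by
    rw [hκ, hv, rieszConst_mul_volume_ball hn, constC, pow_succ 2 (n + 1), add_assoc (n : ℝ)]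
    have := Real.pi_pos
    field_simp
  rw [hRfun, integral_fun_norm_addHaar volume (fun r => G r ^ 2 / r ^ ((n : ℝ) + 1 + δ) * W r),
    integral_fun_norm_addHaar volume φ, finrank_euclideanSpace_fin,
    setIntegral_congr_fun measurableSet_Ioi hφpolar,
    ← setIntegral_congr_fun measurableSet_Ioi hRpolar, integral_const_mul, hconst]
  simp only [nsmul_eq_mul, smul_eq_mul]
  -- `n * v` is the area of the unit sphere, common to both polar integrals.
  have h1 := mul_le_mul_of_nonneg_left hmain (by positivity : 0 ≤ n * v * κ)
  linarith
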